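/- Let $p,q\ge 0$ be integers. Let $\mathbb R^{p,q}$ denote $\mathbb R^{p}\times\mathbb R^{q}$ with the indefinite form $\langle (y_1,y_2),(z_1,z_2)\rangle=y_1\cdot z_1-y_2\cdot z_2$, write $|\nu|^2=\langle\nu,\nu\rangle$, and let $\mathbb R^{p+1,q}=\mathbb R^{p,q}\times\mathbb R$ carry the form $\langle (y,a),(z,b)\rangle=\langle y,z\rangle+ab$. A submanifold is called spacelike if the form is positive definite on its tangent spaces, and an embedding is called spacelike if its image is. A spacelike submanifold is called maximal if it is a stationary point of the induced volume with respect to compactly supported variations. Let $(X,g)$ be a connected $p$-dimensional smooth Riemannian manifold (without boundary, not necessarily complete), let $\delta>0$, and let $f_s:X\to\mathbb R^{p,q}$, $s\in(-\delta,\delta)$, be a smooth family (that is, $(x,s)\mapsto f_s(x)$ is smooth) of spacelike embeddings. Let $c>1$ and define $$\Phi:X\times(-\delta,\delta)\to\mathbb R^{p,q}\times\mathbb R=\mathbb R^{p+1,q},\qquad \Phi(x,s)=(f_s(x),cs).$$ Suppose that 1. $\Phi$ is an isometric embedding, with spacelike image, for the Riemannian product metric $g+ds^2$ on $X\times(-\delta,\delta)$;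 2. the image of $\Phi$ is a maximal spacelike submanifold of $\mathbb R^{p+1,q}$. Then there is a vector $\nu\in\mathbb R^{p,q}$ with $|\nu|^2=1-c^2<0$ such that $f_s(x)=f_0(x)+s\nu$ for all $x\in X$ and all $s\in(-\delta,\delta)$, and the image $f_0(X)$ lies in an affine hyperplane normal to $\nu$, that is, in $\{y:\langle y,\nu\rangle=k\}$ for some $k\in\mathbb R$. -/

import Mathlib

open scoped Manifold ContDiff
open Set MeasureTheory

noncomputable section

/-- The vector space underlying `ℝ^{p,q}`. -/
abbrev Rpq (p q : ℕ) : Type := EuclideanSpace ℝ (Fin p) × EuclideanSpace ℝ (Fin q)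

/-- The standard form of signature `(p,q)` on `ℝ^{p,q}`: `⟨y,z⟩ = y₁ ⬝ z₁ - y₂ ⬝ z₂`. -/
def Rpq.form (p q : ℕ) : LinearMap.BilinForm ℝ (Rpq p q) :=
  (innerₗ (EuclideanSpace ℝ (Fin p))).compl₁₂ (LinearMap.fst ℝ _ _) (LinearMap.fst ℝ _ _) -
    (innerₗ (EuclideanSpace ℝ (Fin q))).compl₁₂ (LinearMap.snd ℝ _ _) (LinearMap.snd ℝ _ _)

theorem Rpq.form_apply (p q : ℕ) (y z : Rpq p q) :
    Rpq.form p q y z = inner ℝ y.1 z.1 - inner ℝ y.2 z.2 := rfl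

/-- The standard form on `ℝ^{p+1,q} = ℝ^{p,q} × ℝ`, positive on the factor `ℝ`. -/
def Rpq.formSucc (p q : ℕ) : LinearMap.BilinForm ℝ (Rpq p q × ℝ) :=
  (Rpq.form p q).compl₁₂ (LinearMap.fst ℝ _ _) (LinearMap.fst ℝ _ _) +
    (LinearMap.mul ℝ ℝ).compl₁₂ (LinearMap.snd ℝ _ _) (LinearMap.snd ℝ _ _)

theorem Rpq.formSucc_apply (p q : ℕ) (y z : Rpq p q × ℝ) :
    Rpq.formSucc p q y z = Rpq.form p q y.1 z.1 + y.2 * z.2 := rfl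

section Submanifolds

variable {W : Type*} [NormedAddCommGroup W] [NormedSpace ℝ W]

/-- `u`, restricted to the open set `U ⊆ ℝᵐ`, is a smooth local parametrisation of `S ⊆ W`:
a smooth immersion which is a homeomorphism of `U` onto a relatively open subset of `S`. -/
structure IsLocalParametrization (m : ℕ) (S : Set W) (U : Set (EuclideanSpace ℝ (Fin m)))
    (u : EuclideanSpace ℝ (Fin m) → W) : Prop where
  isOpen : IsOpen U
  contDiffOn : ContDiffOn ℝ ∞ u U
  injective_fderiv : ∀ x ∈ U, Function.Injective (fderiv ℝ u x)
  isEmbedding : Topology.IsEmbedding (fun x : U ↦ u x)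
  isOpen_image : ∃ O : Set W, IsOpen O ∧ u '' U = S ∩ O

/-- `S` is an `m`-dimensional smooth embedded submanifold of the vector space `W`. -/
def IsEmbeddedSubmanifold (m : ℕ) (S : Set W) : Prop :=
  ∀ y ∈ S, ∃ U u, IsLocalParametrization m S U u ∧ y ∈ u '' U

/-- The Gram matrix `⟨∂ᵢu, ∂ⱼu⟩` at `x` of a map `u` from `ℝᵐ` to `(W, B)`. -/
def gramMatrix (B : LinearMap.BilinForm ℝ W) {m : ℕ} (u : EuclideanSpace ℝ (Fin m) → W)
    (x : EuclideanSpace ℝ (Fin m)) : Matrix (Fin m) (Fin m) ℝ :=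
  Matrix.of fun i j ↦
    B (fderiv ℝ u x (EuclideanSpace.single i 1)) (fderiv ℝ u x (EuclideanSpace.single j 1))

/-- The volume of the piece of the submanifold parametrised by `K`, in the induced metric. -/
def inducedVolume (B : LinearMap.BilinForm ℝ W) {m : ℕ} (u : EuclideanSpace ℝ (Fin m) → W)
    (K : Set (EuclideanSpace ℝ (Fin m))) : ℝ :=
  ∫ x in K, √(gramMatrix B u x).det

/-- `F t`, for `|t| < ε`, is a smooth variation of `u` on `U`, supported in the compact set
`K ⊆ U`. -/
structure IsCompactVariation {m : ℕ} (U K : Set (EuclideanSpace ℝ (Fin m)))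
    (u : EuclideanSpace ℝ (Fin m) → W) (ε : ℝ) (F : ℝ → EuclideanSpace ℝ (Fin m) → W) :
    Prop where
  pos : 0 < ε
  isCompact : IsCompact K
  subset : K ⊆ U
  contDiffOn : ContDiffOn ℝ ∞ (fun z : ℝ × EuclideanSpace ℝ (Fin m) ↦ F z.1 z.2)
    (Ioo (-ε) ε ×ˢ U)
  zero : ∀ x ∈ U, F 0 x = u x
  eq_off : ∀ t ∈ Ioo (-ε) ε, ∀ x ∈ U \ K, F t x = u x

/-- `S` is an `m`-dimensional maximal spacelike submanifold of `(W, B)`: an embedded submanifold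
on whose tangent spaces `B` is positive definite, and which is a stationary point of the induced
volume with respect to compactly supported variations. Since the first variation of the volume is
linear in the variation field, it is enough to consider variations supported in a parametrised
patch. -/
structure IsMaximalSpacelike (B : LinearMap.BilinForm ℝ W) (m : ℕ) (S : Set W) : Prop where
  isEmbeddedSubmanifold : IsEmbeddedSubmanifold m S
  spacelike : ∀ U u, IsLocalParametrization m S U u →
    ∀ x ∈ U, ∀ v ≠ 0, 0 < B (fderiv ℝ u x v) (fderiv ℝ u x v)
  stationary : ∀ U u, IsLocalParametrization m S U u → ∀ K ε F, IsCompactVariation U K u ε F →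
    HasDerivAt (fun t ↦ inducedVolume B (F t) K) 0 0

end Submanifolds

/-- A spacelike embedding of a `p`-manifold in `ℝ^{p,q}`: a smooth embedding such that the
indefinite form is positive definite on the tangent spaces of the image. -/
structure IsSpacelikeEmbedding (p q : ℕ) {X : Type*} [TopologicalSpace X]
    [ChartedSpace (EuclideanSpace ℝ (Fin p)) X] (f : X → Rpq p q) : Prop where
  isSmoothEmbedding : Manifold.IsSmoothEmbedding (𝓡 p) 𝓘(ℝ, Rpq p q) ∞ f
  spacelike : ∀ (x : X) (v : TangentSpace (𝓡 p) x), v ≠ 0 →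
    0 < Rpq.form p q (mfderiv (𝓡 p) 𝓘(ℝ, Rpq p q) f x v) (mfderiv (𝓡 p) 𝓘(ℝ, Rpq p q) f x v)

/-- The product `X × (-δ, δ)`, as an open subset of `X × ℝ`. -/
def tube (X : Type*) [TopologicalSpace X] (δ : ℝ) : TopologicalSpace.Opens (X × ℝ) :=
  ⟨univ ×ˢ Ioo (-δ) δ, isOpen_univ.prod isOpen_Ioo⟩

/-- `Φ` restricts to an isometric embedding of `X × (-δ, δ)`, with the Riemannian product of the
metric `g` on `X` and the standard metric on `(-δ, δ)`, in `ℝ^{p+1,q} = ℝ^{p,q} × ℝ`. -/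
structure IsIsometricEmbeddingProd (p q : ℕ) {X : Type*} [TopologicalSpace X]
    [ChartedSpace (EuclideanSpace ℝ (Fin p)) X] [IsManifold (𝓡 p) ∞ X]
    (g : Bundle.ContMDiffRiemannianMetric (𝓡 p) ∞ (EuclideanSpace ℝ (Fin p))
      (fun x : X ↦ TangentSpace (𝓡 p) x))
    (δ : ℝ) (Φ : X × ℝ → Rpq p q × ℝ) : Prop where
  isSmoothEmbedding : Manifold.IsSmoothEmbedding ((𝓡 p).prod 𝓘(ℝ, ℝ)) 𝓘(ℝ, Rpq p q × ℝ) ∞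
    (fun z : tube X δ ↦ Φ z)
  isometric : ∀ x : X, ∀ s ∈ Ioo (-δ) δ, ∀ (v w : TangentSpace (𝓡 p) x) (a b : ℝ),
    Rpq.formSucc p q
        (mfderiv ((𝓡 p).prod 𝓘(ℝ, ℝ)) 𝓘(ℝ, Rpq p q × ℝ) Φ (x, s) (v, a))
        (mfderiv ((𝓡 p).prod 𝓘(ℝ, ℝ)) 𝓘(ℝ, Rpq p q × ℝ) Φ (x, s) (w, b)) =
      g.inner x v w + a * b

end

/-! Let `u` be `Φ` in local coordinates and `e` the coordinate direction of the factor `(-δ, δ)`.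
For a product metric `e` is a parallel unit field, so `S v = ∂ᵥ∂ₑu` has no tangential part: it is
the second fundamental form `II(v, e)` (`fderiv_parallel_normal`). Put `N = S e`. Differentiating
`⟨S v, ∂w u⟩ = 0` along `e` gives `⟨∂ᵥN, ∂w u⟩ = -⟨S v, S w⟩` (`bilin_fderiv_normal`); this plays
the role of the Gauss equation for the flat planes containing `e`.

The submanifold has the largest dimension a spacelike one can have, so its normal spaces are
negative definite (`Rpq.formSucc_normal_nonpos`). Hence `Q(v, w) = -⟨S v, S w⟩` is positive
semidefinite. The first variation of volume along `φN`, with `φ ≥ 0` a bump function, is the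
integral of `φ` times the trace of `Q` in the induced metric. It vanishes by maximality, so `Q = 0`,
and definiteness gives `S = 0` (`fderiv_fderiv_parallel_eq_zero`).

Thus `∂ₛΦ` is a constant vector `τ = (ν, c)`, first in each patch and then globally by
connectedness. Integration in `s` gives `f_s = f_0 + sν`, and `⟨τ, τ⟩ = 1` gives `|ν|² = 1 - c²`.
Since `∂ₛ` is orthogonal to the factor `X`, `⟨f_0, ν⟩` has zero derivative, whence the hyperplane.
-/

open scoped Matrix

/-! ### Derivative of the determinant; traces against a positive definite matrix -/

section Determinant

variable {n : Type*} [Fintype n] [DecidableEq n]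

theorem contDiff_det : ContDiff ℝ ∞ (fun M : n → n → ℝ ↦ (Matrix.of M).det) := by
  simp only [Matrix.det_apply, Matrix.of_apply]
  fun_prop

/-- Jacobi's formula at an invertible matrix. -/
theorem hasDerivAt_det {M : ℝ → Matrix n n ℝ} {M' : Matrix n n ℝ} {t₀ : ℝ}
    (hM : ∀ i j, HasDerivAt (fun t ↦ M t i j) (M' i j) t₀) (h0 : (M t₀).det ≠ 0) :
    HasDerivAt (fun t ↦ (M t).det) ((M t₀).adjugate * M').trace t₀ := by
  have hd : DifferentiableAt ℝ (fun M : n → n → ℝ ↦ (Matrix.of M).det) (M t₀) :=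
    (contDiff_det.differentiable (by simp)) _
  have hpath : HasDerivAt (fun t ↦ (M t : n → n → ℝ)) M' t₀ :=
    hasDerivAt_pi.2 fun i ↦ hasDerivAt_pi.2 fun j ↦ hM i j
  -- The differential of `det` at `M t₀` is evaluated on `M'` along a straight line: with `M t₀`
  -- factored out, the determinant is a polynomial in `r` whose linear coefficient is the required
  -- trace.
  have hline : HasDerivAt (fun (r : ℝ) (i j : n) ↦ M t₀ i j + r * M' i j)
      (fun i j ↦ M' i j) 0 := by
    refine hasDerivAt_pi.2 fun i ↦ hasDerivAt_pi.2 fun j ↦ ?_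
    simpa using ((hasDerivAt_id (0 : ℝ)).mul_const (M' i j)).const_add (M t₀ i j)
  have h1 := hd.hasFDerivAt.comp_hasDerivAt t₀ hpath
  have h2 := (show HasFDerivAt (fun M : n → n → ℝ ↦ (Matrix.of M).det) _
    (fun i j ↦ M t₀ i j + (0 : ℝ) * M' i j) by
      simpa using hd.hasFDerivAt).comp_hasDerivAt (0 : ℝ) hline
  have hexp : ∀ r : ℝ, (M t₀ + r • M').det =
      (M t₀).det * (1 + ((M t₀)⁻¹ * M').trace * r +
        ((1 + (Polynomial.X : Polynomial ℝ) • ((M t₀)⁻¹ * M').map Polynomial.C).det.divX.divX.eval r)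
          * r ^ 2) := by
    intro r
    rw [← Matrix.det_one_add_smul, ← Matrix.det_mul, Matrix.mul_add, Matrix.mul_one,
      Matrix.mul_smul, ← Matrix.mul_assoc, Matrix.mul_nonsing_inv _ (isUnit_iff_ne_zero.2 h0),
      Matrix.one_mul]
  have h3 : HasDerivAt (fun r : ℝ ↦ (M t₀ + r • M').det)
      ((M t₀).det * ((M t₀)⁻¹ * M').trace) 0 := by
    simp only [hexp]
    have hp := (((1 + (Polynomial.X : Polynomial ℝ) •
      ((M t₀)⁻¹ * M').map Polynomial.C).det.divX.divX).hasDerivAt (0 : ℝ)).mul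
        ((hasDerivAt_id (0 : ℝ)).pow 2)
    have := (((((hasDerivAt_id (0 : ℝ)).const_mul ((M t₀)⁻¹ * M').trace).const_add 1).add
      hp)).const_mul (M t₀).det
    simpa using this
  have h4 := h2.unique h3
  have h5 : (M t₀).det * ((M t₀)⁻¹ * M').trace = ((M t₀).adjugate * M').trace := by
    rw [Matrix.inv_def, Ring.inverse_eq_inv', Matrix.smul_mul, Matrix.trace_smul, smul_eq_mul,
      mul_inv_cancel_left₀ h0]
  rw [h5] at h4
  rw [h4] at h1
  exact h1

open scoped MatrixOrder in
-- Writing `G⁻¹ = Sᴴ S` turns the trace into `det G` times that of the positive semidefinite matrix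
-- `S Q Sᴴ`. A zero trace forces `S Q Sᴴ = 0`, and `S` is invertible.
theorem trace_adjugate_mul_nonneg {G Q : Matrix n n ℝ} (hG : G.PosDef) (hQ : Q.PosSemidef) :
    0 ≤ (G.adjugate * Q).trace ∧ ((G.adjugate * Q).trace = 0 → Q = 0) := by
  have hdet := hG.det_pos
  obtain ⟨S, hS⟩ := CStarAlgebra.nonneg_iff_eq_star_mul_self.1 hG.inv.posSemidef.nonneg
  rw [Matrix.star_eq_conjTranspose] at hS
  have hadj : G.adjugate = G.det • (Sᴴ * S) := by
    rw [← hS, Matrix.inv_def, Ring.inverse_eq_inv', smul_smul, mul_inv_cancel₀ hdet.ne', one_smul]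
  have htr : (G.adjugate * Q).trace = G.det * (S * Q * Sᴴ).trace := by
    rw [hadj, Matrix.smul_mul, Matrix.trace_smul, smul_eq_mul, Matrix.mul_assoc,
      Matrix.trace_mul_comm]
  have hps := hQ.mul_mul_conjTranspose_same S
  refine ⟨htr ▸ mul_nonneg hdet.le hps.trace_nonneg, fun h ↦ ?_⟩
  rw [htr] at h
  have h0 := hps.trace_eq_zero_iff.1 ((mul_eq_zero.1 h).resolve_left hdet.ne')
  have hU : IsUnit S := by
    have : IsUnit (G⁻¹).det := isUnit_iff_ne_zero.2 hG.inv.det_pos.ne'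
    rw [hS, Matrix.det_mul] at this
    exact (Matrix.isUnit_iff_isUnit_det _).2 (isUnit_of_mul_isUnit_right this)
  have hU' : IsUnit Sᴴ := by simpa using hU.star
  have h1 : S * Q = 0 := hU'.mul_left_injective (by simpa using h0)
  exact hU.mul_right_injective (by simpa using h1)

theorem ContinuousOn.trace_adjugate_mul {Z : Type*} [TopologicalSpace Z] {s : Set Z}
    {P Q : Z → Matrix n n ℝ} (hP : ContinuousOn P s) (hQ : ContinuousOn Q s) :
    ContinuousOn (fun z ↦ ((P z).adjugate * Q z).trace) s := by
  rw [continuousOn_iff_continuous_domRestrict] at hP hQ ⊢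
  exact (hP.matrix_adjugate.matrix_mul hQ).matrix_trace

end Determinant

/-! ### Differentiating volume integrals in a parameter -/

section Integral

variable {E : Type*} [TopologicalSpace E] [MeasurableSpace E] [OpensMeasurableSpace E] [T2Space E]
  {μ : Measure E} [IsFiniteMeasureOnCompacts μ]

/-- Differentiation under the integral over a compact set. -/
theorem hasDerivAt_setIntegral_of_isCompact {K : Set E} (hK : IsCompact K) {r : ℝ} (hr : 0 < r)
    {h h' : ℝ → E → ℝ}
    (hderiv : ∀ t ∈ Icc (-r) r, ∀ x ∈ K, HasDerivAt (fun t ↦ h t x) (h' t x) t)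
    (hcont : ∀ t ∈ Icc (-r) r, ContinuousOn (h t) K)
    (hcont' : ContinuousOn (fun z : ℝ × E ↦ h' z.1 z.2) (Icc (-r) r ×ˢ K)) :
    HasDerivAt (fun t ↦ ∫ x in K, h t x ∂μ) (∫ x in K, h' 0 x ∂μ) 0 := by
  have h0 : (0 : ℝ) ∈ Icc (-r) r := ⟨by linarith, hr.le⟩
  obtain ⟨b, hb⟩ := (isCompact_Icc.prod hK).exists_bound_of_continuousOn hcont'
  have hslice : ∀ t ∈ Icc (-r) r, ContinuousOn (h' t) K := fun t ht ↦
    hcont'.comp (f := fun x ↦ (t, x)) (by fun_prop) fun x hx ↦ ⟨ht, hx⟩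
  have hnhds : Icc (-r) r ∈ nhds (0 : ℝ) := Icc_mem_nhds (by linarith) hr
  refine (hasDerivAt_integral_of_dominated_loc_of_deriv_le (bound := fun _ ↦ b)
    hnhds ?_ ((hcont 0 h0).integrableOn_compact' hK hK.measurableSet)
    ((hslice 0 h0).aestronglyMeasurable_of_isCompact hK hK.measurableSet) ?_ ?_ ?_).2
  · filter_upwards [hnhds] with t ht
    exact (hcont t ht).aestronglyMeasurable_of_isCompact hK hK.measurableSet
  · filter_upwards [ae_restrict_mem hK.measurableSet] with x hx t ht
    exact hb (t, x) ⟨ht, hx⟩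
  · exact integrableOn_const hK.measure_lt_top.ne
  · filter_upwards [ae_restrict_mem hK.measurableSet] with x hx t ht
    exact hderiv t ht x hx

/-- The quadratic polynomial in `t` is the shape of the Gram matrix of `u + tV`; only its linear
coefficient `A` enters the derivative at `0`. -/
theorem hasDerivAt_setIntegral_sqrt_det {n : Type*} [Fintype n] [DecidableEq n] {K : Set E}
    (hK : IsCompact K) {G A C : E → Matrix n n ℝ} (hG : ContinuousOn G K) (hA : ContinuousOn A K)
    (hC : ContinuousOn C K) (hpos : ∀ x ∈ K, 0 < (G x).det) :
    HasDerivAt (fun t : ℝ ↦ ∫ x in K, √(G x + t • A x + t ^ 2 • C x).det ∂μ)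
      (∫ x in K, ((G x).adjugate * A x).trace / (2 * √(G x).det) ∂μ) 0 := by
  have hMcont : ContinuousOn (fun z : ℝ × E ↦ G z.2 + z.1 • A z.2 + z.1 ^ 2 • C z.2)
      (univ ×ˢ K) := by
    have hs : MapsTo Prod.snd ((univ : Set ℝ) ×ˢ K) K := fun z hz ↦ hz.2
    exact ((hG.comp continuousOn_snd hs).add
      (continuousOn_fst.smul (hA.comp continuousOn_snd hs))).add
      ((continuousOn_fst.pow 2).smul (hC.comp continuousOn_snd hs))
  have hdcont : ContinuousOn
      (fun z : ℝ × E ↦ (G z.2 + z.1 • A z.2 + z.1 ^ 2 • C z.2).det) (univ ×ˢ K) :=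
    (continuous_id.matrix_det).comp_continuousOn hMcont
  -- Positivity is assumed at `t = 0` only; compactness of `K` gives one interval of `t` for all
  -- `x`, on which the square root stays differentiable.
  obtain ⟨r, hr, hr'⟩ : ∃ r : ℝ, 0 < r ∧ ∀ t ∈ Icc (-r) r, ∀ x ∈ K,
      0 < (G x + t • A x + t ^ 2 • C x).det := by
    have hcK : Continuous fun z : ℝ × K ↦
        (G z.2 + z.1 • A z.2 + z.1 ^ 2 • C z.2).det :=
      hdcont.comp_continuous (f := fun z : ℝ × K ↦ (z.1, (z.2 : E))) (by fun_prop)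
        fun z ↦ ⟨trivial, z.2.2⟩
    have : CompactSpace K := isCompact_iff_compactSpace.1 hK
    have hev : ∀ᶠ t in nhds (0 : ℝ), ∀ x ∈ (univ : Set K),
        0 < (G x + t • A x + t ^ 2 • C x).det := by
      refine isCompact_univ.eventually_forall_of_forall_eventually fun x _ ↦ ?_
      refine hcK.continuousAt.eventually (lt_mem_nhds ?_)
      simpa using hpos x x.2
    obtain ⟨ρ, hρ, hb⟩ := Metric.eventually_nhds_iff.1 hev
    refine ⟨ρ / 2, by positivity, fun t ht x hx ↦ hb ?_ ⟨x, hx⟩ trivial⟩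
    rw [Real.dist_eq, sub_zero]
    exact (abs_le.2 ht).trans_lt (by linarith)
  have key := hasDerivAt_setIntegral_of_isCompact (μ := μ) hK hr
    (h := fun t x ↦ √(G x + t • A x + t ^ 2 • C x).det)
    (h' := fun t x ↦ ((G x + t • A x + t ^ 2 • C x).adjugate * (A x + (2 * t) • C x)).trace /
      (2 * √(G x + t • A x + t ^ 2 • C x).det)) ?_ ?_ ?_
  · simpa using key
  · intro t ht x hx
    refine (hasDerivAt_det (fun i j ↦ ?_) (hr' t ht x hx).ne').sqrt (hr' t ht x hx).ne'
    have := (((hasDerivAt_id t).mul_const (A x i j)).const_add (G x i j)).fun_add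
      (((hasDerivAt_id t).pow 2).mul_const (C x i j))
    simpa using this
  · intro t ht
    exact Real.continuous_sqrt.comp_continuousOn (hdcont.comp (f := fun x ↦ (t, x))
      (by fun_prop) fun x hx ↦ ⟨trivial, hx⟩)
  · have hsub : Icc (-r) r ×ˢ K ⊆ univ ×ˢ K := fun z hz ↦ ⟨trivial, hz.2⟩
    have hs : MapsTo Prod.snd (Icc (-r) r ×ˢ K) K := fun z hz ↦ hz.2
    refine ContinuousOn.div ?_ ?_ ?_
    · exact (hMcont.mono hsub).trace_adjugate_mul ((hA.comp continuousOn_snd hs).add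
        ((continuousOn_const.mul continuousOn_fst).smul (hC.comp continuousOn_snd hs)))
    · exact continuousOn_const.mul
        (Real.continuous_sqrt.comp_continuousOn (hdcont.mono hsub))
    · intro z hz
      have := Real.sqrt_pos.2 (hr' z.1 hz.1 z.2 hz.2)
      positivity

end Integral

/-! ### Second derivatives and the product rule for bilinear forms -/

section Calculus

variable {E W : Type*} [NormedAddCommGroup E] [NormedSpace ℝ E] [NormedAddCommGroup W]
  [NormedSpace ℝ W] {U : Set E} {u : E → W}

theorem ContDiffOn.fderiv_apply_const (hu : ContDiffOn ℝ ∞ u U) (hU : IsOpen U) (v : E) :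
    ContDiffOn ℝ ∞ (fun y ↦ fderiv ℝ u y v) U :=
  (hu.fderiv_of_isOpen hU (by simp)).clm_apply contDiffOn_const

theorem ContDiffOn.differentiableAt_of_isOpen (hu : ContDiffOn ℝ ∞ u U) (hU : IsOpen U) {x : E}
    (hx : x ∈ U) : DifferentiableAt ℝ u x :=
  (hu.contDiffAt (hU.mem_nhds hx)).differentiableAt (by simp)

theorem ContDiffOn.fderiv_fderiv_comm (hu : ContDiffOn ℝ ∞ u U) (hU : IsOpen U) {x : E}
    (hx : x ∈ U) (v w : E) :
    fderiv ℝ (fun y ↦ fderiv ℝ u y v) x w = fderiv ℝ (fun y ↦ fderiv ℝ u y w) x v := by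
  have hd : DifferentiableAt ℝ (fderiv ℝ u) x :=
    (hu.fderiv_of_isOpen hU (m := ∞) (by simp)).differentiableAt_of_isOpen hU hx
  have hs : IsSymmSndFDerivAt ℝ u x :=
    (hu.contDiffAt (hU.mem_nhds hx)).isSymmSndFDerivAt 
      (by simpa using WithTop.coe_le_coe.2 (le_top : (2 : ℕ∞) ≤ ⊤))
  have h : ∀ v w, fderiv ℝ (fun y ↦ fderiv ℝ u y v) x w = fderiv ℝ (fderiv ℝ u) x w v := by
    intro v w
    rw [fderiv_clm_apply hd (by fun_prop)]
    simp
  rw [h, h, hs.eq]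

theorem fderiv_bilin_apply [FiniteDimensional ℝ W] (B : LinearMap.BilinForm ℝ W) {a b : E → W}
    {x : E} (ha : DifferentiableAt ℝ a x) (hb : DifferentiableAt ℝ b x) (v : E) :
    fderiv ℝ (fun y ↦ B (a y) (b y)) x v = B (fderiv ℝ a x v) (b x) + B (a x) (fderiv ℝ b x v) := by
  have := (B.toContinuousBilinearMap.hasFDerivAt_of_bilinear ha.hasFDerivAt hb.hasFDerivAt).fderiv
  simp only [LinearMap.toContinuousBilinearMap_apply] at this
  rw [this]
  simp [add_comm]

/-- The product rule for a bilinear pairing that vanishes on `U`. -/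
theorem bilin_fderiv_add_eq_zero [FiniteDimensional ℝ W] (B : LinearMap.BilinForm ℝ W)
    {a b : E → W} (hU : IsOpen U) (ha : ContDiffOn ℝ ∞ a U) (hb : ContDiffOn ℝ ∞ b U)
    (h0 : ∀ y ∈ U, B (a y) (b y) = 0) {x : E} (hx : x ∈ U) (v : E) :
    B (fderiv ℝ a x v) (b x) + B (a x) (fderiv ℝ b x v) = 0 := by
  rw [← fderiv_bilin_apply B (ha.differentiableAt_of_isOpen hU hx)
    (hb.differentiableAt_of_isOpen hU hx)]
  have : (fun y ↦ B (a y) (b y)) =ᶠ[nhds x] fun _ ↦ 0 := by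
    filter_upwards [hU.mem_nhds hx] with y hy using h0 y hy
  rw [this.fderiv_eq]
  simp

theorem ContinuousOn.bilin {Z : Type*} [TopologicalSpace Z] {s : Set Z} [FiniteDimensional ℝ W]
    (B : LinearMap.BilinForm ℝ W) {a b : Z → W} (ha : ContinuousOn a s) (hb : ContinuousOn b s) :
    ContinuousOn (fun y ↦ B (a y) (b y)) s :=
  (B.toContinuousBilinearMap.isBoundedBilinearMap.continuous).comp_continuousOn (ha.prodMk hb)

end Calculus

/-! ### Consequences of a parallel coordinate direction -/

section Parallel

variable {E W : Type*} [NormedAddCommGroup E] [NormedSpace ℝ E] [NormedAddCommGroup W]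
  [NormedSpace ℝ W] [FiniteDimensional ℝ W] {U : Set E} {u : E → W} {B : LinearMap.BilinForm ℝ W}
  {e : E}

/-- If the induced metric is invariant in the direction `e`, and `e` has constant inner products
with all coordinate directions, then the derivatives of `∂ₑu` are normal to the image of `u`. -/
theorem fderiv_parallel_normal (hB : ∀ y z, B y z = B z y) (hU : IsOpen U)
    (hu : ContDiffOn ℝ ∞ u U)
    (hinv : ∀ x ∈ U, ∀ v w, fderiv ℝ (fun y ↦ B (fderiv ℝ u y v) (fderiv ℝ u y w)) x e = 0)
    (hpar : ∀ x ∈ U, ∀ v w, fderiv ℝ (fun y ↦ B (fderiv ℝ u y e) (fderiv ℝ u y w)) x v = 0)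
    {x : E} (hx : x ∈ U) (v w : E) :
    B (fderiv ℝ (fun y ↦ fderiv ℝ u y e) x v) (fderiv ℝ u x w) = 0 := by
  have hd : ∀ v, DifferentiableAt ℝ (fun y ↦ fderiv ℝ u y v) x := fun v ↦
    (hu.fderiv_apply_const hU v).differentiableAt_of_isOpen hU hx
  -- With `a(v, w) = ⟨∂ᵥ∂ₑu, ∂w u⟩`, the identities `h1` and `h2` share the term `⟨∂ₑu, ∂ᵥ∂w u⟩` and
  -- make `a` symmetric, while `h3` makes it antisymmetric.
  have h1 := hpar x hx v w
  have h2 := hpar x hx w v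
  have h3 := hinv x hx v w
  rw [fderiv_bilin_apply B (hd _) (hd _)] at h1 h2 h3
  rw [hu.fderiv_fderiv_comm hU hx v e, hu.fderiv_fderiv_comm hU hx w e,
    hB (fderiv ℝ u x v)] at h3
  rw [hu.fderiv_fderiv_comm hU hx v w] at h2
  linarith

/-- Under the hypotheses of `fderiv_parallel_normal`, the second fundamental form in the direction
`∂ₑ∂ₑu` is the Gram form of `∂ₑu`. -/
theorem bilin_fderiv_normal (hB : ∀ y z, B y z = B z y) (hU : IsOpen U)
    (hu : ContDiffOn ℝ ∞ u U)
    (hinv : ∀ x ∈ U, ∀ v w, fderiv ℝ (fun y ↦ B (fderiv ℝ u y v) (fderiv ℝ u y w)) x e = 0)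
    (hpar : ∀ x ∈ U, ∀ v w, fderiv ℝ (fun y ↦ B (fderiv ℝ u y e) (fderiv ℝ u y w)) x v = 0)
    {x : E} (hx : x ∈ U) (v w : E) :
    B (fderiv ℝ (fun y ↦ fderiv ℝ (fun z ↦ fderiv ℝ u z e) y e) x v) (fderiv ℝ u x w) =
      -B (fderiv ℝ (fun y ↦ fderiv ℝ u y e) x v) (fderiv ℝ (fun y ↦ fderiv ℝ u y e) x w) := by
  have hue := hu.fderiv_apply_const hU e
  -- The orthogonality relation is differentiated along `e`; commuting derivatives then moves `e`
  -- inside, turning `∂ₑ∂ᵥ∂ₑu` into `∂ᵥ∂ₑ∂ₑu`.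
  have h := bilin_fderiv_add_eq_zero B hU (hue.fderiv_apply_const hU v)
    (hu.fderiv_apply_const hU w)
    (fun y hy ↦ fderiv_parallel_normal hB hU hu hinv hpar hy v w) hx e
  rw [hue.fderiv_fderiv_comm hU hx v e, hu.fderiv_fderiv_comm hU hx w e] at h
  linarith

end Parallel

/-! ### First variation of volume and vanishing of the second fundamental form along `e` -/

section Variation

theorem continuousOn_matrix_of {Z : Type*} [TopologicalSpace Z] {s : Set Z} {m : ℕ}
    {a : Z → Fin m → Fin m → ℝ} (h : ∀ i j, ContinuousOn (fun z ↦ a z i j) s) :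
    ContinuousOn (fun z ↦ Matrix.of (a z)) s := by
  simp only [continuousOn_iff_continuous_domRestrict] at h ⊢
  exact continuous_matrix h

theorem sum_sum_bilin_single {W : Type*} [NormedAddCommGroup W] [NormedSpace ℝ W]
    (B : LinearMap.BilinForm ℝ W) {m : ℕ} (v : EuclideanSpace ℝ (Fin m))
    (T : EuclideanSpace ℝ (Fin m) →L[ℝ] W) :
    ∑ i, ∑ j, v i * B (T (EuclideanSpace.single i 1)) (T (EuclideanSpace.single j 1)) * v j =
      B (T v) (T v) := by
  have hv : v = ∑ i, v i • EuclideanSpace.single i (1 : ℝ) := by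
    ext j
    simp [Finset.sum_apply, Pi.single_apply]
  conv_rhs => rw [hv]
  simp only [map_sum, map_smul, LinearMap.sum_apply, LinearMap.smul_apply, smul_eq_mul,
    Finset.mul_sum]
  rw [Finset.sum_comm]
  refine Finset.sum_congr rfl fun i _ ↦ Finset.sum_congr rfl fun j _ ↦ ?_
  ring

theorem gramMatrix_posDef {W : Type*} [NormedAddCommGroup W] [NormedSpace ℝ W]
    {B : LinearMap.BilinForm ℝ W} {m : ℕ} {u : EuclideanSpace ℝ (Fin m) → W}
    (hB : ∀ y z, B y z = B z y) {x : EuclideanSpace ℝ (Fin m)}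
    (hpos : ∀ v ≠ 0, 0 < B (fderiv ℝ u x v) (fderiv ℝ u x v)) : (gramMatrix B u x).PosDef := by
  refine Matrix.PosDef.of_dotProduct_mulVec_pos ?_ fun v hv ↦ ?_
  · ext i j
    simp [gramMatrix, hB]
  · have h := hpos (WithLp.toLp 2 v) (by simpa using hv)
    rw [← sum_sum_bilin_single] at h
    simpa [dotProduct, Matrix.mulVec, gramMatrix, Finset.mul_sum, mul_assoc] using h

variable {W : Type*} [NormedAddCommGroup W] [NormedSpace ℝ W] [FiniteDimensional ℝ W]
  {B : LinearMap.BilinForm ℝ W} {m : ℕ} {U : Set (EuclideanSpace ℝ (Fin m))}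
  {u : EuclideanSpace ℝ (Fin m) → W}

/-- The first variation of the induced volume in the direction `V`. -/
theorem hasDerivAt_inducedVolume_add_smul (hU : IsOpen U) (hu : ContDiffOn ℝ ∞ u U)
    {K : Set (EuclideanSpace ℝ (Fin m))} (hK : IsCompact K) (hKU : K ⊆ U)
    {V : EuclideanSpace ℝ (Fin m) → W} (hV : ContDiffOn ℝ ∞ V U)
    (hpos : ∀ x ∈ K, 0 < (gramMatrix B u x).det) :
    HasDerivAt (fun t : ℝ ↦ inducedVolume B (fun x ↦ u x + t • V x) K)
      (∫ x in K, ((gramMatrix B u x).adjugate * Matrix.of fun i j ↦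
        B (fderiv ℝ u x (EuclideanSpace.single i 1)) (fderiv ℝ V x (EuclideanSpace.single j 1)) +
        B (fderiv ℝ V x (EuclideanSpace.single i 1))
          (fderiv ℝ u x (EuclideanSpace.single j 1))).trace / (2 * √(gramMatrix B u x).det)) 0 := by
  have cu : ∀ v, ContinuousOn (fun y ↦ fderiv ℝ u y v) K := fun v ↦
    (hu.fderiv_apply_const hU v).continuousOn.mono hKU
  have cV : ∀ v, ContinuousOn (fun y ↦ fderiv ℝ V y v) K := fun v ↦
    (hV.fderiv_apply_const hU v).continuousOn.mono hKU
  have key := hasDerivAt_setIntegral_sqrt_det (μ := volume) hK (G := gramMatrix B u)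
    (A := fun x ↦ Matrix.of fun i j ↦
        B (fderiv ℝ u x (EuclideanSpace.single i 1)) (fderiv ℝ V x (EuclideanSpace.single j 1)) +
        B (fderiv ℝ V x (EuclideanSpace.single i 1)) (fderiv ℝ u x (EuclideanSpace.single j 1)))
    (C := gramMatrix B V)
    (continuousOn_matrix_of fun i j ↦ (cu _).bilin B (cu _))
    (continuousOn_matrix_of fun i j ↦ ((cu _).bilin B (cV _)).add ((cV _).bilin B (cu _)))
    (continuousOn_matrix_of fun i j ↦ (cV _).bilin B (cV _)) hpos
  convert key using 2 with t
  unfold inducedVolume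
  refine setIntegral_congr_fun hK.measurableSet fun x hx ↦ ?_
  have hF : fderiv ℝ (fun x ↦ u x + t • V x) x = fderiv ℝ u x + t • fderiv ℝ V x :=
    ((hu.differentiableAt_of_isOpen hU (hKU hx)).hasFDerivAt.add
      ((hV.differentiableAt_of_isOpen hU (hKU hx)).hasFDerivAt.const_smul t)).fderiv
  have hM : gramMatrix B (fun x ↦ u x + t • V x) x = gramMatrix B u x + t • (Matrix.of fun i j ↦
        B (fderiv ℝ u x (EuclideanSpace.single i 1)) (fderiv ℝ V x (EuclideanSpace.single j 1)) +
        B (fderiv ℝ V x (EuclideanSpace.single i 1)) (fderiv ℝ u x (EuclideanSpace.single j 1))) +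
        t ^ 2 • gramMatrix B V x := by
    ext i j
    simp only [gramMatrix, hF, Matrix.of_apply, Matrix.add_apply, Matrix.smul_apply,
      add_apply, smul_apply, map_add, map_smul,
      LinearMap.add_apply, LinearMap.smul_apply, smul_eq_mul]
    ring
  simp only [hM]

/-- A patch of a maximal spacelike submanifold whose induced metric splits off the parallel
direction `e` is ruled by `e`: the vector `∂ₑu` is constant along the patch. -/
theorem fderiv_fderiv_parallel_eq_zero (hB : ∀ y z, B y z = B z y) (hU : IsOpen U)
    (hu : ContDiffOn ℝ ∞ u U) {e : EuclideanSpace ℝ (Fin m)}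
    (hinv : ∀ x ∈ U, ∀ v w, fderiv ℝ (fun y ↦ B (fderiv ℝ u y v) (fderiv ℝ u y w)) x e = 0)
    (hpar : ∀ x ∈ U, ∀ v w, fderiv ℝ (fun y ↦ B (fderiv ℝ u y e) (fderiv ℝ u y w)) x v = 0)
    (hpos : ∀ x ∈ U, ∀ v ≠ 0, 0 < B (fderiv ℝ u x v) (fderiv ℝ u x v))
    (hneg : ∀ x ∈ U, ∀ n, (∀ v, B n (fderiv ℝ u x v) = 0) → B n n ≤ 0 ∧ (B n n = 0 → n = 0))
    (hstat : ∀ K ε F, IsCompactVariation U K u ε F →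
      HasDerivAt (fun t ↦ inducedVolume B (F t) K) 0 0)
    {x₀ : EuclideanSpace ℝ (Fin m)} (hx₀ : x₀ ∈ U) (v : EuclideanSpace ℝ (Fin m)) :
    fderiv ℝ (fun y ↦ fderiv ℝ u y e) x₀ v = 0 := by
  set S : EuclideanSpace ℝ (Fin m) → EuclideanSpace ℝ (Fin m) → W :=
    fun v x ↦ fderiv ℝ (fun y ↦ fderiv ℝ u y e) x v with hS
  have hSsmooth : ∀ v, ContDiffOn ℝ ∞ (S v) U := fun v ↦
    (hu.fderiv_apply_const hU e).fderiv_apply_const hU v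
  have hSn : ∀ x ∈ U, ∀ v w, B (S v x) (fderiv ℝ u x w) = 0 := fun x hx v w ↦
    fderiv_parallel_normal hB hU hu hinv hpar hx v w
  have hdN : ∀ x ∈ U, ∀ v w, B (fderiv ℝ (S e) x v) (fderiv ℝ u x w) = -B (S v x) (S w x) :=
    fun x hx v w ↦ bilin_fderiv_normal hB hU hu hinv hpar hx v w
  set Q : EuclideanSpace ℝ (Fin m) → Matrix (Fin m) (Fin m) ℝ := fun x ↦ Matrix.of fun i j ↦
    -B (S (EuclideanSpace.single i 1) x) (S (EuclideanSpace.single j 1) x) with hQ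
  have hQpsd : ∀ x ∈ U, (Q x).PosSemidef := by
    intro x hx
    refine Matrix.PosSemidef.of_dotProduct_mulVec_nonneg ?_ fun v ↦ ?_
    · ext i j
      simp [hQ, hB]
    · have h := (hneg x hx (S (WithLp.toLp 2 v) x) (hSn x hx _)).1
      rw [← sum_sum_bilin_single] at h
      simpa [dotProduct, Matrix.mulVec, hQ, Finset.mul_sum, mul_assoc] using h
  obtain ⟨r, hr, hrU⟩ := Metric.nhds_basis_closedBall.mem_iff.1 (hU.mem_nhds hx₀)
  -- The cutoff equals `1` near `x₀` and vanishes outside the ball of radius `r`, so that `φ • S e`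
  -- is an admissible variation field.
  let φ : ContDiffBump x₀ := ⟨r / 2, r, by positivity, by linarith⟩
  set K := Metric.closedBall x₀ r
  have hK : IsCompact K := isCompact_closedBall x₀ r
  have hφ : ContDiff ℝ ∞ φ := φ.contDiff
  have hV : ContDiffOn ℝ ∞ (fun x ↦ φ x • S e x) U := hφ.contDiffOn.smul (hSsmooth e)
  have hG : ∀ x ∈ U, (gramMatrix B u x).PosDef := fun x hx ↦ gramMatrix_posDef hB (hpos x hx)
  have hvar : IsCompactVariation U K u 1 fun t x ↦ u x + t • φ x • S e x :=
    { pos := one_pos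
      isCompact := hK
      subset := hrU
      contDiffOn := by
        have hs : MapsTo Prod.snd (Ioo (-1 : ℝ) 1 ×ˢ U) U := fun z hz ↦ hz.2
        exact (hu.comp contDiffOn_snd hs).add (contDiffOn_fst.smul (hV.comp contDiffOn_snd hs))
      zero := by simp
      eq_off := by
        intro t _ x hx
        have : φ x = 0 := φ.zero_of_le_dist (by
          have := hx.2
          simp only [K, Metric.mem_closedBall, not_le] at this
          exact this.le)
        simp [this] }
  have hvol := (hasDerivAt_inducedVolume_add_smul hU hu hK hrU hV
    fun x hx ↦ (hG x (hrU hx)).det_pos).unique (hstat K 1 _ hvar)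
  have hA : ∀ x ∈ U, (Matrix.of fun i j ↦
        B (fderiv ℝ u x (EuclideanSpace.single i 1))
          (fderiv ℝ (fun x ↦ φ x • S e x) x (EuclideanSpace.single j 1)) +
        B (fderiv ℝ (fun x ↦ φ x • S e x) x (EuclideanSpace.single i 1))
          (fderiv ℝ u x (EuclideanSpace.single j 1))) = (2 * φ x) • Q x := by
    intro x hx
    have hd : fderiv ℝ (fun x ↦ φ x • S e x) x = _ :=
      fderiv_fun_smul ((hφ.differentiable (by simp)) x)
        ((hSsmooth e).differentiableAt_of_isOpen hU hx)
    ext i j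
    simp only [hd, Matrix.of_apply, Matrix.smul_apply, add_apply,
      smul_apply, ContinuousLinearMap.smulRight_apply, map_add, map_smul,
      LinearMap.add_apply, LinearMap.smul_apply, smul_eq_mul, hQ]
    -- The terms containing the derivative of `φ` drop out because `S e` is normal.
    rw [hB (fderiv ℝ u x _) (fderiv ℝ (S e) x _), hB (fderiv ℝ u x _) (S e x), hdN x hx,
      hdN x hx, hSn x hx, hSn x hx, hB (S (EuclideanSpace.single j 1) x)]
    ring
  have hvol' : ∫ x in K, φ x * ((gramMatrix B u x).adjugate * Q x).trace /
      √(gramMatrix B u x).det = 0 := by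
    rw [← hvol]
    refine setIntegral_congr_fun hK.measurableSet fun x hx ↦ ?_
    have hs := (Real.sqrt_pos.2 (hG x (hrU hx)).det_pos).ne'
    simp only [hA x (hrU hx), Matrix.mul_smul, Matrix.trace_smul, smul_eq_mul]
    field_simp
  have hnn := fun x hx ↦ trace_adjugate_mul_nonneg (hG x hx) (hQpsd x hx)
  have hcont : ContinuousOn (fun x ↦ φ x * ((gramMatrix B u x).adjugate * Q x).trace /
      √(gramMatrix B u x).det) K := by
    have cG : ContinuousOn (gramMatrix B u) K := continuousOn_matrix_of fun i j ↦
      (((hu.fderiv_apply_const hU _).continuousOn).bilin B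
        (hu.fderiv_apply_const hU _).continuousOn).mono hrU
    have cQ : ContinuousOn Q K := continuousOn_matrix_of fun i j ↦
      (((hSsmooth _).continuousOn).bilin B (hSsmooth _).continuousOn).neg.mono hrU
    refine (hφ.continuous.continuousOn.mul (cG.trace_adjugate_mul cQ)).div
      (Real.continuous_sqrt.comp_continuousOn
        ((continuous_id.matrix_det).comp_continuousOn cG)) fun x hx ↦ ?_
    exact (Real.sqrt_pos.2 (hG x (hrU hx)).det_pos).ne'
  have hzero : φ x₀ * ((gramMatrix B u x₀).adjugate * Q x₀).trace /
      √(gramMatrix B u x₀).det = 0 := by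
    -- A nonnegative integrand with zero integral vanishes almost everywhere, hence by continuity
    -- everywhere on the open ball, in particular at `x₀`.
    have hae := (setIntegral_eq_zero_iff_of_nonneg_ae
      (by
        filter_upwards [ae_restrict_mem hK.measurableSet] with x hx
        exact div_nonneg (mul_nonneg φ.nonneg (hnn x (hrU hx)).1) (Real.sqrt_nonneg _))
      (hcont.integrableOn_compact hK)).1 hvol'
    have hball : Metric.ball x₀ r ⊆ K := Metric.ball_subset_closedBall
    exact Measure.eqOn_open_of_ae_eq (ae_restrict_of_ae_restrict_of_subset hball hae)
      Metric.isOpen_ball (hcont.mono hball) continuousOn_const (Metric.mem_ball_self hr)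
  have hφ1 : φ x₀ = 1 := φ.one_of_mem_closedBall (by simpa [φ] using (half_pos hr).le)
  have hs := (Real.sqrt_pos.2 (hG x₀ hx₀).det_pos).ne'
  have htr : ((gramMatrix B u x₀).adjugate * Q x₀).trace = 0 := by
    simpa [hφ1, hs] using hzero
  have hQ0 := (hnn x₀ hx₀).2 htr
  have hSv : B (S v x₀) (S v x₀) = 0 := by
    rw [← sum_sum_bilin_single]
    refine Finset.sum_eq_zero fun i _ ↦ Finset.sum_eq_zero fun j _ ↦ ?_
    have := congrFun (congrFun hQ0 i) j
    simp only [hQ, Matrix.of_apply, Matrix.zero_apply, neg_eq_zero] at this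
    simp [hS] at this ⊢
    simp [this]
  exact (hneg x₀ hx₀ _ (hSn x₀ hx₀ v)).2 hSv

end Variation

/-! ### Negative definiteness of the normal space -/

section Normal

theorem Rpq.form_symm (p q : ℕ) (y z : Rpq p q) : Rpq.form p q y z = Rpq.form p q z y := by
  simp only [Rpq.form_apply, real_inner_comm]

theorem Rpq.formSucc_symm (p q : ℕ) (y z : Rpq p q × ℝ) :
    Rpq.formSucc p q y z = Rpq.formSucc p q z y := by
  rw [Rpq.formSucc_apply, Rpq.formSucc_apply, Rpq.form_symm, mul_comm]

theorem Rpq.formSucc_self (p q : ℕ) (y : Rpq p q × ℝ) :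
    Rpq.formSucc p q y y = ‖y.1.1‖ ^ 2 - ‖y.1.2‖ ^ 2 + y.2 ^ 2 := by
  rw [Rpq.formSucc_apply, Rpq.form_apply, real_inner_self_eq_norm_sq, real_inner_self_eq_norm_sq,
    sq y.2]

/-- The normal space to a spacelike subspace of maximal dimension is negative definite. -/
theorem Rpq.formSucc_normal_nonpos (p q : ℕ)
    (T : EuclideanSpace ℝ (Fin (p + 1)) →ₗ[ℝ] Rpq p q × ℝ)
    (hT : ∀ v ≠ 0, 0 < Rpq.formSucc p q (T v) (T v)) {n : Rpq p q × ℝ}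
    (hn : ∀ v, Rpq.formSucc p q n (T v) = 0) :
    Rpq.formSucc p q n n ≤ 0 ∧ (Rpq.formSucc p q n n = 0 → n = 0) := by
  -- `π` forgets the negative factor. Its kernel is negative definite, so `π ∘ T` is injective and,
  -- by dimension, bijective. Choosing `v` with `π (T v) = π n` puts `n - T v` in the negative
  -- factor; since `n ⊥ T v`, this gives `⟨n, n⟩ = -‖n.1.2 - (T v).1.2‖² - ⟨T v, T v⟩`.
  let π : Rpq p q × ℝ →ₗ[ℝ] EuclideanSpace ℝ (Fin p) × ℝ :=
    (LinearMap.fst ℝ _ _).prodMap LinearMap.id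
  have hinj : Function.Injective (π ∘ₗ T) := by
    refine (injective_iff_map_eq_zero _).2 fun v hv ↦ ?_
    by_contra hne
    have h := hT v hne
    have h1 : (T v).1.1 = 0 := congrArg Prod.fst hv
    have h2 : (T v).2 = 0 := congrArg Prod.snd hv
    rw [Rpq.formSucc_self, h1, h2] at h
    have := sq_nonneg ‖(T v).1.2‖
    simp at h
    linarith
  have hsurj : Function.Surjective (π ∘ₗ T) :=
    (LinearMap.injective_iff_surjective_of_finrank_eq_finrank (by simp)).1 hinj
  obtain ⟨v, hv⟩ := hsurj (π n)
  have h1 : (T v).1.1 = n.1.1 := congrArg (fun y ↦ y.1) hv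
  have h2 : (T v).2 = n.2 := congrArg (fun y ↦ y.2) hv
  have hd : Rpq.formSucc p q (n - T v) (n - T v) = -‖n.1.2 - (T v).1.2‖ ^ 2 := by
    rw [Rpq.formSucc_self]
    simp [h1, h2]
  have he : Rpq.formSucc p q (n - T v) (n - T v) =
      Rpq.formSucc p q n n + Rpq.formSucc p q (T v) (T v) := by
    simp only [map_sub, LinearMap.sub_apply, hn, Rpq.formSucc_symm p q (T v) n]
    ring
  have hsq := sq_nonneg ‖n.1.2 - (T v).1.2‖
  by_cases hv0 : v = 0
  · subst hv0
    simp only [map_zero, add_zero, sub_zero] at hd he h1 h2 hsq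
    simp only [Prod.snd_zero, Prod.fst_zero, sub_zero] at hd h1 h2 hsq
    refine ⟨by linarith, fun h ↦ ?_⟩
    have h3 : n.1.2 = 0 := by
      rw [h] at hd
      simpa using hd.symm
    exact Prod.ext (Prod.ext h1.symm h3) h2.symm
  · have := hT v hv0
    exact ⟨by linarith, fun h ↦ by linarith⟩

end Normal

/-! ### Coordinate patches of the product -/

section Patch

variable {p q : ℕ} {X : Type*} [TopologicalSpace X] [ChartedSpace (EuclideanSpace ℝ (Fin p)) X]

/-- The parametrisation of a part of `X × (-δ, δ)` given by a chart of `X` and a linear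
identification of `ℝ^{p+1}` with `ℝᵖ × ℝ`. -/
noncomputable def tubePatch
    (L : EuclideanSpace ℝ (Fin (p + 1)) ≃L[ℝ] EuclideanSpace ℝ (Fin p) × ℝ) (δ : ℝ) (x₀ : X) :
    OpenPartialHomeomorph (EuclideanSpace ℝ (Fin (p + 1))) (X × ℝ) :=
  L.toHomeomorph.toOpenPartialHomeomorph.trans
    ((chartAt (EuclideanSpace ℝ (Fin p)) x₀).symm.prod
      (OpenPartialHomeomorph.ofSet (Ioo (-δ) δ) isOpen_Ioo))

variable (L : EuclideanSpace ℝ (Fin (p + 1)) ≃L[ℝ] EuclideanSpace ℝ (Fin p) × ℝ) (δ : ℝ) (x₀ : X)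

theorem mem_tubePatch_source {z : EuclideanSpace ℝ (Fin (p + 1))} :
    z ∈ (tubePatch L δ x₀).source ↔
      (L z).1 ∈ (chartAt (EuclideanSpace ℝ (Fin p)) x₀).target ∧ (L z).2 ∈ Ioo (-δ) δ := by
  simp [tubePatch]

theorem mem_tubePatch_target {a : X × ℝ} :
    a ∈ (tubePatch L δ x₀).target ↔
      a.1 ∈ (chartAt (EuclideanSpace ℝ (Fin p)) x₀).source ∧ a.2 ∈ Ioo (-δ) δ := by
  simp [tubePatch]

/-- A function on `X × (-δ, δ)` with vanishing derivative in all patches is constant. -/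
theorem eq_of_fderiv_comp_tubePatch_eq_zero [ConnectedSpace X] {Z : Type*} [NormedAddCommGroup Z]
    [NormedSpace ℝ Z] {k : X × ℝ → Z}
    (hk : ∀ x₀ : X, ∀ z ∈ (tubePatch L δ x₀).source,
      HasFDerivAt (fun y ↦ k (tubePatch L δ x₀ y)) (0 : _ →L[ℝ] Z) z)
    {a b : X × ℝ} (ha : a.2 ∈ Ioo (-δ) δ) (hb : b.2 ∈ Ioo (-δ) δ) : k a = k b := by
  have hpre : IsPreconnected ((univ : Set X) ×ˢ Ioo (-δ) δ) :=
    isPreconnected_univ.prod isPreconnected_Ioo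
  refine eq_of_germ_isConstant_on (s := univ ×ˢ Ioo (-δ) δ) (fun c hc ↦ ?_) hpre
    ⟨trivial, ha⟩ ⟨trivial, hb⟩
  set ψ := tubePatch L δ c.1
  have hct : c ∈ ψ.target := (mem_tubePatch_target L δ c.1).2 ⟨mem_chart_source _ _, hc.2⟩
  -- Vanishing derivative gives constancy only on connected sets, and the patch domain need not be
  -- connected; a ball inside it is.
  obtain ⟨r, hr, hball⟩ := Metric.isOpen_iff.1 ψ.open_source _ (ψ.map_target hct)
  refine ⟨k c, ?_⟩
  filter_upwards [ψ.open_target.mem_nhds hct,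
    (ψ.continuousAt_symm hct).eventually (Metric.ball_mem_nhds _ hr)] with y hy hyb
  have := Metric.isOpen_ball.is_const_of_fderiv_eq_zero (𝕜 := ℝ)
    (convex_ball (ψ.symm c) r).isPreconnected
    (fun z hz ↦ (hk c.1 z (hball hz)).differentiableAt.differentiableWithinAt)
    (fun z hz ↦ (hk c.1 z (hball hz)).fderiv) hyb (Metric.mem_ball_self hr)
  change k (ψ (ψ.symm y)) = k (ψ (ψ.symm c)) at this
  rwa [ψ.right_inv hy, ψ.right_inv hct] at this

variable [IsManifold (𝓡 p) ∞ X]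

theorem contMDiffOn_tubePatch :
    ContMDiffOn 𝓘(ℝ, EuclideanSpace ℝ (Fin (p + 1))) ((𝓡 p).prod 𝓘(ℝ, ℝ)) ∞ (tubePatch L δ x₀)
      (tubePatch L δ x₀).source := by
  have hL : ContMDiff 𝓘(ℝ, EuclideanSpace ℝ (Fin (p + 1))) 𝓘(ℝ, EuclideanSpace ℝ (Fin p)) ∞
      (fun z ↦ (L z).1) := ContDiff.contMDiff (by fun_prop)
  have hL' : ContMDiff 𝓘(ℝ, EuclideanSpace ℝ (Fin (p + 1))) 𝓘(ℝ, ℝ) ∞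
      (fun z ↦ (L z).2) := ContDiff.contMDiff (by fun_prop)
  exact ((contMDiffOn_chart_symm (I := 𝓡 p) (x := x₀)).comp hL.contMDiffOn
    fun z hz ↦ ((mem_tubePatch_source L δ x₀).1 hz).1).prodMk hL'.contMDiffOn

theorem mfderiv_tubePatch {z : EuclideanSpace ℝ (Fin (p + 1))}
    (hz : z ∈ (tubePatch L δ x₀).source) (v : EuclideanSpace ℝ (Fin (p + 1))) :
    mfderiv 𝓘(ℝ, EuclideanSpace ℝ (Fin (p + 1))) ((𝓡 p).prod 𝓘(ℝ, ℝ)) (tubePatch L δ x₀) z v =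
      (mfderiv (𝓡 p) (𝓡 p) (chartAt (EuclideanSpace ℝ (Fin p)) x₀).symm (L z).1 (L v).1,
        (L v).2) := by
  have hz' := ((mem_tubePatch_source L δ x₀).1 hz).1
  let L₁ : EuclideanSpace ℝ (Fin (p + 1)) →L[ℝ] EuclideanSpace ℝ (Fin p) :=
    (ContinuousLinearMap.fst ℝ _ _).comp (L : _ →L[ℝ] EuclideanSpace ℝ (Fin p) × ℝ)
  let L₂ : EuclideanSpace ℝ (Fin (p + 1)) →L[ℝ] ℝ :=
    (ContinuousLinearMap.snd ℝ _ _).comp (L : _ →L[ℝ] EuclideanSpace ℝ (Fin p) × ℝ)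
  have h1 : HasMFDerivAt 𝓘(ℝ, EuclideanSpace ℝ (Fin (p + 1))) (𝓡 p) (fun z ↦ (L z).1) z L₁ :=
    L₁.hasFDerivAt.hasMFDerivAt
  have h2 : HasMFDerivAt 𝓘(ℝ, EuclideanSpace ℝ (Fin (p + 1))) 𝓘(ℝ, ℝ) (fun z ↦ (L z).2) z L₂ :=
    L₂.hasFDerivAt.hasMFDerivAt
  have h3 : MDifferentiableAt (𝓡 p) (𝓡 p) (chartAt (EuclideanSpace ℝ (Fin p)) x₀).symm (L z).1 :=
    ((contMDiffOn_chart_symm (I := 𝓡 p) (n := ∞) (x := x₀)).contMDiffAt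
      ((chartAt (EuclideanSpace ℝ (Fin p)) x₀).open_target.mem_nhds hz')).mdifferentiableAt
      (by simp)
  have h4 := (h3.hasMFDerivAt.comp z h1).prodMk h2
  exact congrArg (fun A ↦ A v) h4.mfderiv

end Patch

/-- A patch of a maximal spacelike submanifold whose induced metric is the product of a metric
`Θ` on `ℝᵖ` and the standard metric on `ℝ` has constant derivative along the factor `ℝ`. -/
theorem hasFDerivAt_fderiv_of_isMaximalSpacelike {p q : ℕ}
    (L : EuclideanSpace ℝ (Fin (p + 1)) ≃L[ℝ] EuclideanSpace ℝ (Fin p) × ℝ)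
    {S : Set (Rpq p q × ℝ)} {U : Set (EuclideanSpace ℝ (Fin (p + 1)))}
    {u : EuclideanSpace ℝ (Fin (p + 1)) → Rpq p q × ℝ}
    {Θ : EuclideanSpace ℝ (Fin p) → EuclideanSpace ℝ (Fin p) → EuclideanSpace ℝ (Fin p) → ℝ}
    (hpatch : IsLocalParametrization (p + 1) S U u)
    (h_max : IsMaximalSpacelike (Rpq.formSucc p q) (p + 1) S)
    (hpos : ∀ x ∈ U, ∀ v ≠ 0, 0 < Rpq.formSucc p q (fderiv ℝ u x v) (fderiv ℝ u x v))
    (hG : ∀ x ∈ U, ∀ v w, Rpq.formSucc p q (fderiv ℝ u x v) (fderiv ℝ u x w) =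
      Θ (L x).1 (L v).1 (L w).1 + (L v).2 * (L w).2)
    (hΘ : ∀ y w, Θ y 0 w = 0) {z : EuclideanSpace ℝ (Fin (p + 1))} (hz : z ∈ U) :
    HasFDerivAt (fun y ↦ fderiv ℝ u y (L.symm (0, 1))) (0 : _ →L[ℝ] Rpq p q × ℝ) z := by
  have hU := hpatch.isOpen
  have hu := hpatch.contDiffOn
  obtain ⟨e, he⟩ : ∃ e, e = L.symm (0, 1) := ⟨_, rfl⟩
  have hLe : L e = (0, 1) := by rw [he, L.apply_symm_apply]
  rw [← he]
  have hneg : ∀ x ∈ U, ∀ n, (∀ v, Rpq.formSucc p q n (fderiv ℝ u x v) = 0) →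
      Rpq.formSucc p q n n ≤ 0 ∧ (Rpq.formSucc p q n n = 0 → n = 0) := fun x hx n hn ↦
    Rpq.formSucc_normal_nonpos p q (fderiv ℝ u x).toLinearMap (fun v hv ↦ hpos x hx v hv) hn
  have hinv : ∀ x ∈ U, ∀ v w,
      fderiv ℝ (fun y ↦ Rpq.formSucc p q (fderiv ℝ u y v) (fderiv ℝ u y w)) x e = 0 := by
    intro x hx v w
    have hd : DifferentiableAt ℝ (fun y ↦ Rpq.formSucc p q (fderiv ℝ u y v) (fderiv ℝ u y w)) x :=
      ((Rpq.formSucc p q).toContinuousBilinearMap.hasFDerivAt_of_bilinear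
        ((hu.fderiv_apply_const hU v).differentiableAt_of_isOpen hU hx).hasFDerivAt
        ((hu.fderiv_apply_const hU w).differentiableAt_of_isOpen hU hx).hasFDerivAt
        ).differentiableAt
    have hline : HasDerivAt (fun t : ℝ ↦ x + t • e) e 0 := by
      simpa using ((hasDerivAt_id (0 : ℝ)).smul_const e).const_add x
    have hd' := hd.hasFDerivAt
    rw [show x = x + (0 : ℝ) • e by simp] at hd'
    have hcomp := hd'.comp_hasDerivAt (0 : ℝ) hline
    rw [zero_smul, add_zero] at hcomp
    refine hcomp.unique ((hasDerivAt_const (0 : ℝ)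
      (Rpq.formSucc p q (fderiv ℝ u x v) (fderiv ℝ u x w))).congr_of_eventuallyEq ?_)
    have hmem : ∀ᶠ t : ℝ in nhds 0, x + t • e ∈ U :=
      hline.continuousAt.eventually (hU.mem_nhds (by simpa using hx))
    filter_upwards [hmem] with t ht
    -- Moving along `e` changes only the `ℝ` coordinate, on which `Θ` does not depend.
    have hfst : (L (x + t • e)).1 = (L x).1 := by simp [hLe]
    simp only [Function.comp_apply, hG _ ht, hG _ hx, hfst]
  have hpar : ∀ x ∈ U, ∀ v w,
      fderiv ℝ (fun y ↦ Rpq.formSucc p q (fderiv ℝ u y e) (fderiv ℝ u y w)) x v = 0 := by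
    intro x hx v w
    have hev : (fun y ↦ Rpq.formSucc p q (fderiv ℝ u y e) (fderiv ℝ u y w)) =ᶠ[nhds x]
        fun _ ↦ (L w).2 := by
      filter_upwards [hU.mem_nhds hx] with y hy
      rw [hG y hy, hLe]
      simp [hΘ]
    rw [hev.fderiv_eq]
    simp
  have hzero : fderiv ℝ (fun y ↦ fderiv ℝ u y e) z = 0 :=
    ContinuousLinearMap.ext fun v ↦ fderiv_fderiv_parallel_eq_zero (Rpq.formSucc_symm p q) hU hu
      hinv hpar hpos hneg (h_max.stationary _ _ hpatch) hz v
  rw [← hzero]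
  exact ((hu.fderiv_apply_const hU e).differentiableAt_of_isOpen hU hz).hasFDerivAt

/-! ### The isometric embedding in coordinates -/

section IsometricPatch

variable {p q : ℕ} {X : Type*} [TopologicalSpace X] [ChartedSpace (EuclideanSpace ℝ (Fin p)) X]
  [IsManifold (𝓡 p) ∞ X]
  {g : Bundle.ContMDiffRiemannianMetric (𝓡 p) ∞ (EuclideanSpace ℝ (Fin p))
      (fun x : X ↦ TangentSpace (𝓡 p) x)}
  {δ : ℝ} {Φ : X × ℝ → Rpq p q × ℝ}
  (L : EuclideanSpace ℝ (Fin (p + 1)) ≃L[ℝ] EuclideanSpace ℝ (Fin p) × ℝ) (x₀ : X)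

/-- The derivative of the inverse of a chart. -/
noncomputable def chartSymmDeriv (x₀ : X) (y : EuclideanSpace ℝ (Fin p)) :
    EuclideanSpace ℝ (Fin p) →L[ℝ] EuclideanSpace ℝ (Fin p) :=
  mfderiv (𝓡 p) (𝓡 p) (chartAt (EuclideanSpace ℝ (Fin p)) x₀).symm y

/-- The derivative of a map on `X × ℝ`, in the trivialisations given by the preferred charts. -/
noncomputable def tubeDeriv (Φ : X × ℝ → Rpq p q × ℝ) (a : X × ℝ) :
    EuclideanSpace ℝ (Fin p) × ℝ →L[ℝ] Rpq p q × ℝ :=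
  mfderiv ((𝓡 p).prod 𝓘(ℝ, ℝ)) 𝓘(ℝ, Rpq p q × ℝ) Φ a

/-- The coordinate expression of the metric `g` in the chart at `x₀`. -/
noncomputable def patchMetric
    (g : Bundle.ContMDiffRiemannianMetric (𝓡 p) ∞ (EuclideanSpace ℝ (Fin p))
      (fun x : X ↦ TangentSpace (𝓡 p) x)) (x₀ : X) (y v w : EuclideanSpace ℝ (Fin p)) : ℝ :=
  g.inner ((chartAt (EuclideanSpace ℝ (Fin p)) x₀).symm y) (chartSymmDeriv x₀ y v)
    (chartSymmDeriv x₀ y w)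

variable (g) in
theorem patchMetric_zero_left (y w : EuclideanSpace ℝ (Fin p)) : patchMetric g x₀ y 0 w = 0 := by
  unfold patchMetric
  rw [map_zero]
  exact congrArg (fun A ↦ A (chartSymmDeriv x₀ y w))
    (map_zero (g.inner ((chartAt (EuclideanSpace ℝ (Fin p)) x₀).symm y)))

variable (g) in
theorem patchMetric_zero_right (y v : EuclideanSpace ℝ (Fin p)) : patchMetric g x₀ y v 0 = 0 := by
  unfold patchMetric
  rw [map_zero]
  exact map_zero (g.inner ((chartAt (EuclideanSpace ℝ (Fin p)) x₀).symm y)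
    (chartSymmDeriv x₀ y v))

variable (g) in
theorem patchMetric_pos {y v : EuclideanSpace ℝ (Fin p)}
    (hy : y ∈ (chartAt (EuclideanSpace ℝ (Fin p)) x₀).target) (hv : v ≠ 0) :
    0 < patchMetric g x₀ y v v := by
  have hinj := (mdifferentiable_chart (I := 𝓡 p) x₀).symm.mfderiv_injective hy
  exact g.pos _ _ fun h ↦ hv (hinj (h.trans (map_zero _).symm))

theorem contDiffOn_comp_tubePatch
    (hΦ : ContMDiffOn ((𝓡 p).prod 𝓘(ℝ, ℝ)) 𝓘(ℝ, Rpq p q × ℝ) ∞ Φ (univ ×ˢ Ioo (-δ) δ)) :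
    ContDiffOn ℝ ∞ (fun z ↦ Φ (tubePatch L δ x₀ z)) (tubePatch L δ x₀).source :=
  contMDiffOn_iff_contDiffOn.1 (hΦ.comp (contMDiffOn_tubePatch L δ x₀)
    fun _ hz ↦ ⟨trivial, ((mem_tubePatch_source L δ x₀).1 hz).2⟩)

theorem fderiv_comp_tubePatch
    (hΦ : ContMDiffOn ((𝓡 p).prod 𝓘(ℝ, ℝ)) 𝓘(ℝ, Rpq p q × ℝ) ∞ Φ (univ ×ˢ Ioo (-δ) δ))
    {z : EuclideanSpace ℝ (Fin (p + 1))} (hz : z ∈ (tubePatch L δ x₀).source)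
    (v : EuclideanSpace ℝ (Fin (p + 1))) :
    fderiv ℝ (fun z ↦ Φ (tubePatch L δ x₀ z)) z v =
      tubeDeriv Φ (tubePatch L δ x₀ z) (chartSymmDeriv x₀ (L z).1 (L v).1, (L v).2) := by
  have hopen : IsOpen ((univ : Set X) ×ˢ Ioo (-δ) δ) := isOpen_univ.prod isOpen_Ioo
  have h1 : MDifferentiableAt ((𝓡 p).prod 𝓘(ℝ, ℝ)) 𝓘(ℝ, Rpq p q × ℝ) Φ (tubePatch L δ x₀ z) :=
    (hΦ.contMDiffAt (hopen.mem_nhds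
      ⟨trivial, ((mem_tubePatch_source L δ x₀).1 hz).2⟩)).mdifferentiableAt (by simp)
  have h2 := ((contMDiffOn_tubePatch L δ x₀).contMDiffAt
    ((tubePatch L δ x₀).open_source.mem_nhds hz)).mdifferentiableAt (by simp)
  rw [← mfderiv_eq_fderiv]
  exact (congrArg (fun A ↦ A v) (mfderiv_comp z h1 h2)).trans
    (congrArg (tubeDeriv Φ (tubePatch L δ x₀ z)) (mfderiv_tubePatch L δ x₀ hz v))

theorem formSucc_fderiv_comp_tubePatch
    (hΦ : ContMDiffOn ((𝓡 p).prod 𝓘(ℝ, ℝ)) 𝓘(ℝ, Rpq p q × ℝ) ∞ Φ (univ ×ˢ Ioo (-δ) δ))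
    (h_isom : IsIsometricEmbeddingProd p q g δ Φ)
    {z : EuclideanSpace ℝ (Fin (p + 1))} (hz : z ∈ (tubePatch L δ x₀).source)
    (v w : EuclideanSpace ℝ (Fin (p + 1))) :
    Rpq.formSucc p q (fderiv ℝ (fun z ↦ Φ (tubePatch L δ x₀ z)) z v)
        (fderiv ℝ (fun z ↦ Φ (tubePatch L δ x₀ z)) z w) =
      patchMetric g x₀ (L z).1 (L v).1 (L w).1 + (L v).2 * (L w).2 := by
  rw [fderiv_comp_tubePatch L x₀ hΦ hz, fderiv_comp_tubePatch L x₀ hΦ hz]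
  exact h_isom.isometric _ _ ((mem_tubePatch_source L δ x₀).1 hz).2 _ _ _ _

theorem formSucc_fderiv_comp_tubePatch_pos
    (hΦ : ContMDiffOn ((𝓡 p).prod 𝓘(ℝ, ℝ)) 𝓘(ℝ, Rpq p q × ℝ) ∞ Φ (univ ×ˢ Ioo (-δ) δ))
    (h_isom : IsIsometricEmbeddingProd p q g δ Φ)
    {z : EuclideanSpace ℝ (Fin (p + 1))} (hz : z ∈ (tubePatch L δ x₀).source)
    {v : EuclideanSpace ℝ (Fin (p + 1))} (hv : v ≠ 0) :
    0 < Rpq.formSucc p q (fderiv ℝ (fun z ↦ Φ (tubePatch L δ x₀ z)) z v)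
        (fderiv ℝ (fun z ↦ Φ (tubePatch L δ x₀ z)) z v) := by
  rw [formSucc_fderiv_comp_tubePatch L x₀ hΦ h_isom hz]
  by_cases h1 : (L v).1 = 0
  · have h2 : (L v).2 ≠ 0 := fun h2 ↦ hv (L.map_eq_zero_iff.1 (Prod.ext h1 h2))
    rw [h1, patchMetric_zero_left, zero_add]
    exact mul_self_pos.2 h2
  · exact add_pos_of_pos_of_nonneg
      (patchMetric_pos g x₀ ((mem_tubePatch_source L δ x₀).1 hz).1 h1) (mul_self_nonneg _)

theorem isLocalParametrization_comp_tubePatch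
    (hΦ : ContMDiffOn ((𝓡 p).prod 𝓘(ℝ, ℝ)) 𝓘(ℝ, Rpq p q × ℝ) ∞ Φ (univ ×ˢ Ioo (-δ) δ))
    (h_isom : IsIsometricEmbeddingProd p q g δ Φ) :
    IsLocalParametrization (p + 1) (Φ '' (univ ×ˢ Ioo (-δ) δ)) (tubePatch L δ x₀).source
      (fun z ↦ Φ (tubePatch L δ x₀ z)) where
  isOpen := (tubePatch L δ x₀).open_source
  contDiffOn := contDiffOn_comp_tubePatch L x₀ hΦ
  injective_fderiv := by
    intro z hz
    refine (injective_iff_map_eq_zero _).2 fun v hv ↦ ?_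
    by_contra hne
    have := formSucc_fderiv_comp_tubePatch_pos L x₀ hΦ h_isom hz hne
    rw [hv] at this
    simp at this
  isEmbedding := by
    have h1 := (tubePatch L δ x₀).isOpenEmbedding_restrict.isEmbedding.codRestrict
      (tube X δ : Set (X × ℝ)) fun z ↦ ⟨trivial, ((mem_tubePatch_source L δ x₀).1 z.2).2⟩
    exact h_isom.isSmoothEmbedding.isEmbedding.comp h1
  isOpen_image := by
    -- The patch covers an open part of the tube, and an embedding carries it to a relatively open
    -- part of the image.
    have hopen : IsOpen ((↑) ⁻¹' (tubePatch L δ x₀).target : Set (tube X δ)) :=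
      (tubePatch L δ x₀).open_target.preimage continuous_subtype_val
    obtain ⟨O, hO, hO'⟩ := h_isom.isSmoothEmbedding.isEmbedding.isOpen_iff.1 hopen
    refine ⟨O, hO, Subset.antisymm ?_ ?_⟩
    · rintro _ ⟨z, hz, rfl⟩
      have hm : tubePatch L δ x₀ z ∈ (univ : Set X) ×ˢ Ioo (-δ) δ :=
        ⟨trivial, ((mem_tubePatch_source L δ x₀).1 hz).2⟩
      refine ⟨mem_image_of_mem _ hm, ?_⟩
      have : (⟨tubePatch L δ x₀ z, hm⟩ : tube X δ) ∈
          ((↑) ⁻¹' (tubePatch L δ x₀).target : Set (tube X δ)) := (tubePatch L δ x₀).map_source hz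
      rw [← hO'] at this
      exact this
    · rintro _ ⟨⟨a, ha, rfl⟩, haO⟩
      have : (⟨a, ha⟩ : tube X δ) ∈ ((fun z : tube X δ ↦ Φ z) ⁻¹' O) := haO
      rw [hO'] at this
      refine ⟨(tubePatch L δ x₀).symm a, (tubePatch L δ x₀).map_target this, ?_⟩
      simp only [(tubePatch L δ x₀).right_inv this]

/-- On a maximal isometrically embedded product, the `s`-derivative is constant along patches. -/
theorem hasFDerivAt_fderiv_comp_tubePatch
    (hΦ : ContMDiffOn ((𝓡 p).prod 𝓘(ℝ, ℝ)) 𝓘(ℝ, Rpq p q × ℝ) ∞ Φ (univ ×ˢ Ioo (-δ) δ))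
    (h_isom : IsIsometricEmbeddingProd p q g δ Φ)
    (h_max : IsMaximalSpacelike (Rpq.formSucc p q) (p + 1) (Φ '' (univ ×ˢ Ioo (-δ) δ)))
    {z : EuclideanSpace ℝ (Fin (p + 1))} (hz : z ∈ (tubePatch L δ x₀).source) :
    HasFDerivAt (fun y ↦ fderiv ℝ (fun z ↦ Φ (tubePatch L δ x₀ z)) y (L.symm (0, 1)))
      (0 : _ →L[ℝ] Rpq p q × ℝ) z :=
  hasFDerivAt_fderiv_of_isMaximalSpacelike L
    (isLocalParametrization_comp_tubePatch L x₀ hΦ h_isom) h_max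
    (fun _ hy _ hv ↦ formSucc_fderiv_comp_tubePatch_pos L x₀ hΦ h_isom hy hv)
    (fun _ hy v w ↦ formSucc_fderiv_comp_tubePatch L x₀ hΦ h_isom hy v w)
    (patchMetric_zero_left g x₀) hz

end IsometricPatch

/-! ### Affine dependence on `s` and the hyperplane -/

theorem lemma4 (p q : ℕ) {X : Type*} [TopologicalSpace X]
    [ChartedSpace (EuclideanSpace ℝ (Fin p)) X] [IsManifold (𝓡 p) ∞ X] [ConnectedSpace X]
    (g : Bundle.ContMDiffRiemannianMetric (𝓡 p) ∞ (EuclideanSpace ℝ (Fin p))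
      (fun x : X ↦ TangentSpace (𝓡 p) x))
    (δ : ℝ) (hδ : 0 < δ) (f : ℝ → X → Rpq p q)
    (hf_smooth : ContMDiffOn ((𝓡 p).prod 𝓘(ℝ, ℝ)) 𝓘(ℝ, Rpq p q) ∞
      (fun z : X × ℝ ↦ f z.2 z.1) (univ ×ˢ Ioo (-δ) δ))
    (hf : ∀ s ∈ Ioo (-δ) δ, IsSpacelikeEmbedding p q (f s))
    (c : ℝ) (hc : 1 < c) (Φ : X × ℝ → Rpq p q × ℝ) (hΦ : ∀ z, Φ z = (f z.2 z.1, c * z.2))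
    (h_isom : IsIsometricEmbeddingProd p q g δ Φ)
    (h_max : IsMaximalSpacelike (Rpq.formSucc p q) (p + 1) (Φ '' (univ ×ˢ Ioo (-δ) δ))) :
    ∃ ν : Rpq p q,
      Rpq.form p q ν ν = 1 - c ^ 2 ∧ 1 - c ^ 2 < 0 ∧
      (∀ s ∈ Ioo (-δ) δ, ∀ x : X, f s x = f 0 x + s • ν) ∧
      ∃ k : ℝ, range (f 0) ⊆ {y | Rpq.form p q y ν = k} := by
  have h0 : (0 : ℝ) ∈ Ioo (-δ) δ := ⟨by linarith, hδ⟩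
  obtain ⟨o⟩ : Nonempty X := inferInstance
  let L : EuclideanSpace ℝ (Fin (p + 1)) ≃L[ℝ] EuclideanSpace ℝ (Fin p) × ℝ :=
    ContinuousLinearEquiv.ofFinrankEq (by simp)
  have hΦs : ContMDiffOn ((𝓡 p).prod 𝓘(ℝ, ℝ)) 𝓘(ℝ, Rpq p q × ℝ) ∞ Φ (univ ×ˢ Ioo (-δ) δ) := by
    have hsnd : ContMDiffOn ((𝓡 p).prod 𝓘(ℝ, ℝ)) 𝓘(ℝ, ℝ) ∞ (fun z : X × ℝ ↦ c * z.2)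
        (univ ×ˢ Ioo (-δ) δ) :=
      ((ContDiff.contMDiff (contDiff_const.mul contDiff_id)).comp contMDiff_snd).contMDiffOn
    exact (hf_smooth.prodMk_space hsnd).congr fun z _ ↦ hΦ z
  -- This is `∂ₛΦ`, defined without reference to a patch, so that its local constancy in the patches
  -- can be globalised.
  let T : X × ℝ → Rpq p q × ℝ := fun a ↦ tubeDeriv Φ a (0, 1)
  have hT : ∀ x₀ : X, ∀ z ∈ (tubePatch L δ x₀).source, T (tubePatch L δ x₀ z) =
      fderiv ℝ (fun z ↦ Φ (tubePatch L δ x₀ z)) z (L.symm (0, 1)) := by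
    intro x₀ z hz
    rw [fderiv_comp_tubePatch L x₀ hΦs hz, L.apply_symm_apply, map_zero]
  have hTconst : ∀ a : X × ℝ, a.2 ∈ Ioo (-δ) δ → T a = T (o, 0) := by
    intro a ha
    refine eq_of_fderiv_comp_tubePatch_eq_zero L δ (fun x₀ z hz ↦ ?_) ha h0
    refine (hasFDerivAt_fderiv_comp_tubePatch L x₀ hΦs h_isom h_max hz).congr_of_eventuallyEq ?_
    filter_upwards [(tubePatch L δ x₀).open_source.mem_nhds hz] with y hy using hT x₀ y hy
  have hderiv : ∀ x : X, ∀ s ∈ Ioo (-δ) δ, HasDerivAt (fun s ↦ Φ (x, s)) (T (o, 0)) s := by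
    intro x s hs
    rw [← hTconst (x, s) hs]
    have h1 : MDifferentiableAt ((𝓡 p).prod 𝓘(ℝ, ℝ)) 𝓘(ℝ, Rpq p q × ℝ) Φ (x, s) :=
      (hΦs.contMDiffAt ((isOpen_univ.prod isOpen_Ioo).mem_nhds ⟨trivial, hs⟩)).mdifferentiableAt
        (by simp)
    have h2 : HasMFDerivAt 𝓘(ℝ, ℝ) ((𝓡 p).prod 𝓘(ℝ, ℝ)) (fun s : ℝ ↦ (x, s)) s _ :=
      (hasMFDerivAt_const x s).prodMk (hasMFDerivAt_id s)
    have h3 : HasFDerivAt (fun s ↦ Φ (x, s))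
        ((tubeDeriv Φ (x, s)).comp (ContinuousLinearMap.inr ℝ (EuclideanSpace ℝ (Fin p)) ℝ)) s :=
      hasMFDerivAt_iff_hasFDerivAt.1 (h1.hasMFDerivAt.comp s h2)
    simpa [T] using h3.hasDerivAt
  set τ := T (o, 0) with hτ
  have hτ2 : τ.2 = c := by
    have h1 : HasDerivAt (fun s ↦ (Φ (o, s)).2) τ.2 0 :=
      (ContinuousLinearMap.snd ℝ (Rpq p q) ℝ).hasFDerivAt.comp_hasDerivAt (0 : ℝ) (hderiv o 0 h0)
    simp only [hΦ] at h1
    exact h1.unique (by simpa using (hasDerivAt_id (0 : ℝ)).const_mul c)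
  have hline : ∀ s ∈ Ioo (-δ) δ, ∀ x, Φ (x, s) = Φ (x, 0) + s • τ := by
    intro s hs x
    have hd : ∀ s ∈ Ioo (-δ) δ, HasDerivAt (fun s ↦ Φ (x, s) - s • τ) 0 s := fun s hs ↦ by
      simpa using (hderiv x s hs).fun_sub ((hasDerivAt_id s).smul_const τ)
    have := isOpen_Ioo.is_const_of_deriv_eq_zero isPreconnected_Ioo
      (fun s hs ↦ (hd s hs).differentiableAt.differentiableWithinAt)
      (fun s hs ↦ (hd s hs).deriv) hs h0
    simp only [zero_smul, sub_zero] at this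
    exact sub_eq_iff_eq_add.1 this
  have hlevel : ∀ x, Rpq.formSucc p q (Φ (x, 0)) τ = Rpq.formSucc p q (Φ (o, 0)) τ := by
    intro x
    -- Isometry with `τ = ∂ₛΦ` gives `⟨dΦ(v, a), τ⟩ = a`, so subtracting `s` from `⟨Φ, τ⟩` leaves a
    -- function with zero derivative.
    have := eq_of_fderiv_comp_tubePatch_eq_zero L δ
      (k := fun a ↦ Rpq.formSucc p q (Φ a) τ - a.2) (fun x₀ z hz ↦ ?_)
      (a := (x, 0)) (b := (o, 0)) h0 h0
    · simpa using this
    · have hu := (contDiffOn_comp_tubePatch L x₀ hΦs).differentiableAt_of_isOpen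
        (tubePatch L δ x₀).open_source hz
      have h1 := ((Rpq.formSucc p q).toContinuousBilinearMap.flip τ).hasFDerivAt.comp z
        hu.hasFDerivAt
      have h2 : HasFDerivAt (fun z ↦ (L z).2) ((ContinuousLinearMap.snd ℝ _ _).comp
          (L : _ →L[ℝ] EuclideanSpace ℝ (Fin p) × ℝ)) z :=
        (ContinuousLinearMap.snd ℝ (EuclideanSpace ℝ (Fin p)) ℝ).hasFDerivAt.comp z L.hasFDerivAt
      refine (h1.fun_sub h2).congr_fderiv ?_
      ext v
      have hτz : τ = fderiv ℝ (fun z ↦ Φ (tubePatch L δ x₀ z)) z (L.symm (0, 1)) := by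
        rw [← hT x₀ z hz, hTconst _ ((mem_tubePatch_source L δ x₀).1 hz).2]
      have h3 := formSucc_fderiv_comp_tubePatch L x₀ hΦs h_isom hz v (L.symm (0, 1))
      rw [← hτz, L.apply_symm_apply] at h3
      rw [patchMetric_zero_right, zero_add, mul_one] at h3
      simpa [sub_eq_zero] using h3
  refine ⟨τ.1, ?_, by nlinarith, fun s hs x ↦ ?_, Rpq.form p q (f 0 o) τ.1, ?_⟩
  -- The unit length of `∂ₛ` reads `⟨ν, ν⟩ + c² = 1`.
  · have h := h_isom.isometric o 0 h0 0 0 1 1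
    have h' : Rpq.formSucc p q τ τ = 1 := h.trans (by rw [map_zero]; simp)
    rw [Rpq.formSucc_apply, hτ2] at h'
    linarith
  · have h := congrArg (fun y ↦ y.1) (hline s hs x)
    simpa [hΦ] using h
  · rintro _ ⟨x, rfl⟩
    have h := hlevel x
    simpa [hΦ, Rpq.formSucc_apply] using h
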